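/- A (nondeterministic B\"uchi) automaton is a tuple $\mathcal{A}=\langle\Sigma,Q,\delta,Q_0,\alpha\rangle$, where $\Sigma$ is a finite alphabet, $Q$ is a finite set of states, $\delta:Q\times\Sigma\to 2^Q$ is a transition function, $Q_0\subseteq Q$ is a set of initial states and $\alpha\subseteq Q$ is a set of accepting states. An infinite word $w=\sigma_1\sigma_2\cdots\in\Sigma^\omega$ is accepted by $\mathcal{A}$ if there is a sequence of states $q_0,q_1,\ldots$ with $q_0\in Q_0$ and $q_{i+1}\in\delta(q_i,\sigma_{i+1})$ for all $i\ge 0$ in which some state of $\alpha$ occurs infinitely often; $\mathfrak{L}(\mathcal{A})\subseteq\Sigma^\omega$ is the set of accepted words. For $w,w'\in\Sigma^\omega$ write $w\sim w'$ if every letter of $\Sigma$ has the same number of occurrences in $\{0,1,2,\ldots\}\cup\{\infty\}$ in $w$ and in $w'$. The jumping language of $\mathcal{A}$ is $$\mathfrak{J}(\mathcal{A})=\{w\in\Sigma^\omega \mid \text{there is } w'\sim w \text{ with } w'\in\mathfrak{L}(\mathcal{A})\}.$$ **Proposition.** For every automaton $\mathcal{A}$ over a finite alphabet $\Sigma$ there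 exists an automaton $\mathcal{B}$ over $\Sigma$ such that $\mathfrak{J}(\mathcal{B})=\Sigma^\omega\setminus\mathfrak{J}(\mathcal{A})$. -/

import Mathlib

/-!
An automaton over the finite alphabet `α` with finite state set `Q` is Mathlib's `NFA α Q`
(transition function, set of initial states, set of accepting states) together with `[Finite α]`
and `[Finite Q]`; here it reads infinite words `w : ℕ → α`, with the Büchi acceptance condition.
-/

namespace JumpingAutomata

universe u v

/-- `ρ` is a run of `A` on the infinite word `w`. The letters of `w` are indexed from `0`, so the
step from `ρ i` to `ρ (i + 1)` reads `w i`. -/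
def IsRun {α : Type u} {Q : Type v} (A : NFA α Q) (w : ℕ → α) (ρ : ℕ → Q) : Prop :=
  ρ 0 ∈ A.start ∧ ∀ i, ρ (i + 1) ∈ A.step (ρ i) (w i)

/-- The set of states that occur infinitely often in `ρ`. -/
def infStates {Q : Type v} (ρ : ℕ → Q) : Set Q :=
  {q | ∀ i : ℕ, ∃ j > i, ρ j = q}

/-- The language of infinite words accepted by `A` under the Büchi condition. -/
def omegaLanguage {α : Type u} {Q : Type v} (A : NFA α Q) : Set (ℕ → α) :=
  {w | ∃ ρ : ℕ → Q, IsRun A w ρ ∧ (infStates ρ ∩ A.accept).Nonempty}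

/-- The Parikh image of an infinite word: the number of occurrences of each letter, `⊤` if there
are infinitely many. -/
noncomputable def parikh {α : Type u} (w : ℕ → α) : α → ℕ∞ :=
  fun a => Set.encard {i : ℕ | w i = a}

/-- Two infinite words are permutations of each other if they have the same Parikh image. -/
def IsPermutation {α : Type u} (w w' : ℕ → α) : Prop :=
  parikh w = parikh w'

/-- The jumping language of `A`: the infinite words with a permutation accepted by `A`. -/
def jumpingLanguage {α : Type u} {Q : Type v} (A : NFA α Q) : Set (ℕ → α) :=
  {w | ∃ w' : ℕ → α, IsPermutation w' w ∧ w' ∈ omegaLanguage A}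

end JumpingAutomata

/-!
Fix the set `S` of letters that occur infinitely often. An accepted word with this set is a finite
prefix followed by a word over `S`, and the Parikh vector of the prefix matters only outside `S`;
the Parikh vectors of the paths between two states form a semilinear set (Parikh's theorem, by
Kleene's induction on the permitted intermediate states). Hence every `S`-section of the Parikh
image of a Büchi automaton is semilinear, and so is its complement. Conversely, for `S ≠ ∅` and a
linear set `b + ⟨T⟩` there is a Büchi automaton which reads a vector of `b + ⟨T⟩` letter by letter,
in any order, and then cycles through `S` forever. Finite unions of such automata realize every
family of semilinear sections.
-/

namespace JumpingAutomata

open Filter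
open scoped Pointwise

section Mask

variable {α : Type*} {S T : Set α} {x y : α → ℕ} {a : α}

/-- The Parikh image with value `⊤` on `S` and values given by `x` elsewhere. In particular
`mask ∅` is the embedding of finite Parikh vectors. -/
noncomputable def mask (S : Set α) (x : α → ℕ) : α → ℕ∞ :=
  open Classical in fun a => if a ∈ S then ⊤ else (x a : ℕ∞)

theorem mask_of_mem (h : a ∈ S) : mask S x a = ⊤ := if_pos h

theorem mask_of_notMem (h : a ∉ S) : mask S x a = x a := if_neg h

theorem mask_eq_top_iff : mask S x a = ⊤ ↔ a ∈ S := by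
  simp [mask]

theorem mask_eq_mask_iff : mask S x = mask S y ↔ ∀ a ∉ S, x a = y a := by
  simp only [funext_iff, mask]
  refine forall_congr' fun a => ?_
  by_cases ha : a ∈ S <;> simp [ha]

theorem mask_add_mask (S T : Set α) (x y : α → ℕ) :
    mask S x + mask T y = mask (S ∪ T) (x + y) := by
  ext1 a
  by_cases hS : a ∈ S <;> by_cases hT : a ∈ T <;> simp [mask, hS, hT]

theorem mask_empty_add_mask (S : Set α) (x y : α → ℕ) :
    mask ∅ x + mask S y = mask S (x + y) := by
  rw [mask_add_mask, Set.empty_union]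

theorem mask_empty_zero : mask (∅ : Set α) 0 = 0 := by
  ext1 a
  simp [mask]

theorem mask_single_add_of_mem [DecidableEq α] (ha : a ∈ S) (x : α → ℕ) :
    mask S (Pi.single a 1 + x) = mask S x := by
  refine mask_eq_mask_iff.2 fun c hc => ?_
  have hca : c ≠ a := fun h => hc (h ▸ ha)
  simp [hca]

theorem exists_mask_eq (c : α → ℕ∞) : ∃ x, mask {a | c a = ⊤} x = c := by
  refine ⟨fun a => (c a).toNat, funext fun a => ?_⟩
  by_cases ha : c a = ⊤
  · rw [mask_of_mem (S := {a | c a = ⊤}) ha, ha]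
  · rw [mask_of_notMem (S := {a | c a = ⊤}) ha, ENat.natCast_toNat ha]

end Mask

section Parikh

variable {α : Type*} {w : ℕ → α} {a : α}

theorem frequently_atTop_add_nat_iff {p : ℕ → Prop} (n : ℕ) :
    (∃ᶠ i in atTop, p (i + n)) ↔ ∃ᶠ i in atTop, p i := by
  rw [← frequently_map (m := (· + n)) (P := p), map_add_atTop_eq_nat]

theorem parikh_eq_top_iff : parikh w a = ⊤ ↔ ∃ᶠ i in atTop, w i = a := by
  rw [parikh, Set.encard_eq_top_iff, ← Nat.frequently_atTop_iff_infinite]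

theorem parikh_eq_zero_iff : parikh w a = 0 ↔ ∀ i, w i ≠ a := by
  rw [parikh, Set.encard_eq_zero, Set.eq_empty_iff_forall_notMem]
  rfl

theorem exists_parikh_eq_top [Finite α] (w : ℕ → α) : ∃ a, parikh w a = ⊤ := by
  obtain ⟨a, ha⟩ := Finite.exists_infinite_fiber w
  exact ⟨a, Set.encard_eq_top_iff.2 (Set.infinite_coe_iff.1 ha)⟩

theorem parikh_eq_mask_zero_iff {S : Set α} :
    parikh w = mask S 0 ↔ (∀ i, w i ∈ S) ∧ ∀ a ∈ S, ∃ᶠ i in atTop, w i = a := by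
  constructor
  · intro h
    refine ⟨fun i => by_contra fun hi => ?_, fun a ha => ?_⟩
    · have : parikh w (w i) = 0 := by rw [h, mask_of_notMem hi, Pi.zero_apply, Nat.cast_zero]
      exact parikh_eq_zero_iff.1 this i rfl
    · rw [← parikh_eq_top_iff, h, mask_of_mem ha]
  · rintro ⟨hmem, hfreq⟩
    ext1 a
    by_cases ha : a ∈ S
    · rw [mask_of_mem ha, parikh_eq_top_iff]
      exact hfreq a ha
    · rw [mask_of_notMem ha, Pi.zero_apply, Nat.cast_zero, parikh_eq_zero_iff]
      rintro i rfl
      exact ha (hmem i)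

theorem parikh_eq_single_add [DecidableEq α] (w : ℕ → α) :
    parikh w = mask ∅ (Pi.single (w 0) 1) + parikh fun i => w (i + 1) := by
  ext1 a
  have hunion : {i | w i = a} = {i | i = 0 ∧ w 0 = a} ∪ Nat.succ '' {i | w (i + 1) = a} := by
    ext i
    cases i <;> simp
  have hdisj : Disjoint {i | i = 0 ∧ w 0 = a} (Nat.succ '' {i | w (i + 1) = a}) := by
    rw [Set.disjoint_left]
    rintro _ ⟨rfl, _⟩ ⟨j, _, hj⟩
    exact Nat.succ_ne_zero j hj
  rw [Pi.add_apply, parikh, parikh, hunion, Set.encard_union_eq hdisj,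
    Nat.succ_injective.encard_image, mask_of_notMem (Set.notMem_empty a)]
  congr 1
  by_cases h : w 0 = a
  · simp [h]
  · simp [h, Ne.symm h]

theorem exists_parikh_add_eq_mask_zero [Finite α] {S : Set α} {x : α → ℕ}
    (h : parikh w = mask S x) : ∃ n, parikh (fun i => w (i + (n + 1))) = mask S 0 := by
  have hev : ∀ᶠ i in atTop, ∀ a, a ∉ S → w i ≠ a := by
    refine eventually_all.2 fun a => ?_
    by_cases ha : a ∈ S
    · exact .of_forall fun _ hn => (hn ha).elim
    · have hfin : parikh w a ≠ ⊤ := by rwa [h, Ne, mask_eq_top_iff]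
      rw [Ne, parikh_eq_top_iff, not_frequently] at hfin
      exact hfin.mono fun _ hi _ => hi
  obtain ⟨n, hn⟩ := eventually_atTop.1 hev
  refine ⟨n, parikh_eq_mask_zero_iff.2 ⟨fun i => ?_, fun a ha => ?_⟩⟩
  · exact by_contra fun hi => hn (i + (n + 1)) (by omega) _ hi rfl
  · rw [frequently_atTop_add_nat_iff (p := fun i => w i = a), ← parikh_eq_top_iff, h,
      mask_of_mem ha]

theorem frequently_add_natCast_eq {k : ℕ} [NeZero k] (j l : ZMod k) :
    ∃ᶠ i : ℕ in atTop, j + i = l := by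
  refine frequently_atTop.2 fun n => ⟨(l - j).val + k * n, ?_, by simp⟩
  exact (Nat.le_mul_of_pos_left n (NeZero.pos k)).trans (Nat.le_add_left _ _)

theorem parikh_cyclic {k : ℕ} [NeZero k] (e : ZMod k → α) (j : ZMod k) :
    parikh (fun i : ℕ => e (j + i)) = mask (Set.range e) 0 := by
  refine parikh_eq_mask_zero_iff.2 ⟨fun i => Set.mem_range_self _, ?_⟩
  rintro _ ⟨l, rfl⟩
  exact (frequently_add_natCast_eq j l).mono fun i hi => by rw [hi]

theorem induction_add_single [Finite α] [DecidableEq α] {motive : (α → ℕ) → Prop} (zero : motive 0)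
    (add_single : ∀ x a, motive x → motive (x + Pi.single a 1)) (x : α → ℕ) : motive x := by
  suffices ∀ y, motive y → motive (y + x) by simpa using this 0 zero
  refine Pi.single_induction (fun x => ∀ y, motive y → motive (y + x)) x ?_ ?_ ?_
  · exact fun y hy => by rwa [add_zero]
  · intro f g hf hg y hy
    rw [← add_assoc]
    exact hg _ (hf y hy)
  · intro a n y hy
    induction n with
    | zero => rwa [Pi.single_zero, add_zero]
    | succ n ih =>
      rw [Pi.single_add, ← add_assoc]
      exact add_single _ a ih

end Parikh

section Paths

variable {α Q : Type*} [DecidableEq α]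

/-- `PathIn A K p v q`: there is a nonempty path of `A` from `p` to `q` whose intermediate states
all lie in `K` and whose label has Parikh vector `v`. -/
inductive PathIn (A : NFA α Q) (K : Set Q) (p : Q) : (α → ℕ) → Q → Prop
  | single {a : α} {q : Q} : q ∈ A.step p a → PathIn A K p (Pi.single a 1) q
  | snoc {v : α → ℕ} {q r : Q} {a : α} :
      PathIn A K p v q → q ∈ K → r ∈ A.step q a → PathIn A K p (v + Pi.single a 1) r

variable {A : NFA α Q} {K K' : Set Q} {p q r : Q} {v w : α → ℕ}

theorem PathIn.mono (hK : K ⊆ K') (h : PathIn A K p v q) : PathIn A K' p v q := by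
  induction h with
  | single hstep => exact .single hstep
  | snoc _ hq hstep ih => exact .snoc ih (hK hq) hstep

theorem PathIn.trans (h : PathIn A K p v q) (hq : q ∈ K) (h' : PathIn A K q w r) :
    PathIn A K p (v + w) r := by
  induction h' with
  | single hstep => exact .snoc h hq hstep
  | snoc _ hq' hstep ih => rw [← add_assoc]; exact .snoc ih hq' hstep

theorem PathIn.add_closure (h : PathIn A K p v q) (hq : q ∈ K)
    (hw : w ∈ AddSubmonoid.closure {u | PathIn A K q u q}) : PathIn A K p (v + w) q := by
  induction hw using AddSubmonoid.closure_induction_right with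
  | zero => rwa [add_zero]
  | add_right x _ y hy ih => rw [← add_assoc]; exact ih.trans hq hy

theorem setOf_pathIn_insert (A : NFA α Q) (K : Set Q) (k p q : Q) :
    {v | PathIn A (insert k K) p v q} = {v | PathIn A K p v q} ∪
      ({v | PathIn A K p v k} + (AddSubmonoid.closure {v | PathIn A K k v k} : Set (α → ℕ)) +
        {v | PathIn A K k v q}) := by
  have hsub : K ⊆ insert k K := Set.subset_insert k K
  have hk : k ∈ insert k K := Set.mem_insert k K
  ext v
  constructor
  · intro h
    induction h with
    | single hstep => exact .inl (.single hstep)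
    | @snoc v q r a _ hq hstep ih =>
      rcases hq with rfl | hq <;> rcases ih with ih | ⟨_, ⟨x, hx, y, hy, rfl⟩, z, hz, rfl⟩
      · exact .inr ⟨v, ⟨v, ih, 0, zero_mem _, add_zero v⟩, _, .single hstep, rfl⟩
      · have hyz := add_mem hy (AddSubmonoid.subset_closure hz)
        exact .inr ⟨_, ⟨x, hx, y + z, hyz, rfl⟩, _, .single hstep, by simp only [add_assoc]⟩
      · exact .inl (.snoc ih hq hstep)
      · exact .inr ⟨_, ⟨x, hx, y, hy, rfl⟩, _, .snoc hz hq hstep, by simp only [add_assoc]⟩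
  · rintro (h | ⟨_, ⟨x, hx, y, hy, rfl⟩, z, hz, rfl⟩)
    · exact h.mono hsub
    · have hy' := AddSubmonoid.closure_mono (fun _ hu => PathIn.mono hsub hu) hy
      exact ((hx.mono hsub).add_closure hk hy').trans hk (hz.mono hsub)

theorem isSemilinearSet_setOf_pathIn [Finite α] (A : NFA α Q) (hK : K.Finite) (p q : Q) :
    IsSemilinearSet {v | PathIn A K p v q} := by
  induction K, hK using Set.Finite.induction_on generalizing p q with
  | empty =>
    refine .of_finite ((Set.finite_range fun a : α => (Pi.single a 1 : α → ℕ)).subset ?_)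
    rintro _ (_ | ⟨_, hmem, _⟩)
    · exact Set.mem_range_self _
    · exact hmem.elim
  | insert _ _ ih =>
    rw [setOf_pathIn_insert]
    exact (ih p q).union (((ih p _).add (ih _ _).closure).add (ih _ q))

end Paths

section Runs

variable {α Q : Type*} {A : NFA α Q} {q : Q} {w : ℕ → α} {ρ : ℕ → Q}

/-- `ρ` is a run on `w` of the automaton `A` started in the state `q`, initial or not. -/
def IsRunFrom (A : NFA α Q) (q : Q) (w : ℕ → α) (ρ : ℕ → Q) : Prop :=
  ρ 0 = q ∧ ∀ i, ρ (i + 1) ∈ A.step (ρ i) (w i)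

/-- The language of infinite words accepted by `A` when it is started in the state `q`. -/
def omegaLanguageFrom (A : NFA α Q) (q : Q) : Set (ℕ → α) :=
  {w | ∃ ρ, IsRunFrom A q w ρ ∧ (infStates ρ ∩ A.accept).Nonempty}

/-- The Parikh images of the words accepted by `A` when it is started in the state `q`. -/
def parikhImageFrom (A : NFA α Q) (q : Q) : Set (α → ℕ∞) :=
  parikh '' omegaLanguageFrom A q

/-- The Parikh images of the words accepted by `A`; they determine the jumping language. -/
def parikhImage (A : NFA α Q) : Set (α → ℕ∞) :=
  parikh '' omegaLanguage A

theorem mem_jumpingLanguage_iff : w ∈ jumpingLanguage A ↔ parikh w ∈ parikhImage A :=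
  exists_congr fun _ => and_comm

theorem omegaLanguage_eq_biUnion (A : NFA α Q) :
    omegaLanguage A = ⋃ q ∈ A.start, omegaLanguageFrom A q := by
  ext w
  simp only [omegaLanguage, omegaLanguageFrom, IsRun, IsRunFrom, Set.mem_iUnion,
    Set.mem_ofPred_eq, exists_prop]
  constructor
  · rintro ⟨ρ, ⟨hstart, hstep⟩, hacc⟩
    exact ⟨ρ 0, hstart, ρ, ⟨rfl, hstep⟩, hacc⟩
  · rintro ⟨_, hstart, ρ, ⟨rfl, hstep⟩, hacc⟩
    exact ⟨ρ, ⟨hstart, hstep⟩, hacc⟩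

theorem parikhImage_eq_biUnion (A : NFA α Q) :
    parikhImage A = ⋃ q ∈ A.start, parikhImageFrom A q := by
  simp only [parikhImage, parikhImageFrom, omegaLanguage_eq_biUnion, Set.image_iUnion]

theorem mem_infStates_iff : q ∈ infStates ρ ↔ ∃ᶠ i in atTop, ρ i = q :=
  frequently_atTop'.symm

theorem infStates_add (ρ : ℕ → Q) (n : ℕ) : infStates (fun i => ρ (i + n)) = infStates ρ := by
  ext q
  rw [mem_infStates_iff, mem_infStates_iff, frequently_atTop_add_nat_iff (p := fun i => ρ i = q)]

theorem IsRunFrom.add (h : IsRunFrom A q w ρ) (n : ℕ) :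
    IsRunFrom A (ρ n) (fun i => w (i + n)) (fun i => ρ (i + n)) :=
  ⟨congrArg ρ (zero_add n), fun i => by simpa only [add_right_comm] using h.2 (i + n)⟩

theorem mem_omegaLanguageFrom_iff_exists_step :
    w ∈ omegaLanguageFrom A q ↔
      ∃ r ∈ A.step q (w 0), (fun i => w (i + 1)) ∈ omegaLanguageFrom A r := by
  constructor
  · rintro ⟨ρ, hρ, hacc⟩
    obtain ⟨rfl, hstep⟩ := id hρ
    exact ⟨ρ 1, hstep 0, _, hρ.add 1, by rwa [infStates_add]⟩
  · rintro ⟨_, hr, ρ, ⟨rfl, hstep⟩, hacc⟩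
    refine ⟨fun i => Nat.casesOn i q ρ, ⟨rfl, ?_⟩, ?_⟩
    · rintro (_ | i)
      · exact hr
      · exact hstep i
    · rwa [← infStates_add _ 1]

variable [DecidableEq α]

theorem single_add_mem_parikhImageFrom {a : α} {r : Q} {c : α → ℕ∞} (hr : r ∈ A.step q a)
    (hc : c ∈ parikhImageFrom A r) : mask ∅ (Pi.single a 1) + c ∈ parikhImageFrom A q := by
  obtain ⟨w, hw, rfl⟩ := hc
  refine ⟨fun i => Nat.casesOn i a w, ?_, parikh_eq_single_add _⟩
  exact mem_omegaLanguageFrom_iff_exists_step.2 ⟨r, hr, hw⟩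

theorem PathIn.add_mem_parikhImageFrom {K : Set Q} {p : Q} {v : α → ℕ} {c : α → ℕ∞}
    (h : PathIn A K p v q) (hc : c ∈ parikhImageFrom A q) :
    mask ∅ v + c ∈ parikhImageFrom A p := by
  induction h generalizing c with
  | single hstep => exact single_add_mem_parikhImageFrom hstep hc
  | snoc _ _ hstep ih =>
    rw [← mask_empty_add_mask, add_assoc]
    exact ih (single_add_mem_parikhImageFrom hstep hc)

theorem IsRunFrom.exists_pathIn (h : IsRunFrom A q w ρ) (n : ℕ) :
    ∃ v, PathIn A Set.univ q v (ρ (n + 1)) ∧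
      parikh w = mask ∅ v + parikh (fun i => w (i + (n + 1))) := by
  obtain ⟨rfl, hstep⟩ := h
  induction n with
  | zero => exact ⟨_, .single (hstep 0), parikh_eq_single_add w⟩
  | succ n ih =>
    obtain ⟨v, hpath, hv⟩ := ih
    refine ⟨_, .snoc hpath (Set.mem_univ _) (hstep (n + 1)), ?_⟩
    rw [hv, parikh_eq_single_add fun i => w (i + (n + 1)), ← add_assoc, mask_empty_add_mask]
    simp only [zero_add, add_assoc, add_comm 1]

theorem mask_mem_parikhImageFrom_iff [Finite α] {S : Set α} {x : α → ℕ} {p : Q} :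
    mask S x ∈ parikhImageFrom A p ↔ ∃ q, mask S 0 ∈ parikhImageFrom A q ∧
      ∃ v, PathIn A Set.univ p v q ∧ ∀ a ∉ S, v a = x a := by
  constructor
  · rintro ⟨w, ⟨ρ, hρ, hacc⟩, hw⟩
    obtain ⟨n, hn⟩ := exists_parikh_add_eq_mask_zero hw
    obtain ⟨v, hpath, hv⟩ := hρ.exists_pathIn n
    refine ⟨_, ⟨_, ⟨_, hρ.add (n + 1), ?_⟩, hn⟩, v, hpath, ?_⟩
    · rwa [infStates_add]
    · rw [← mask_eq_mask_iff, ← hw, hv, hn, mask_empty_add_mask, add_zero]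
  · rintro ⟨q, hq, v, hpath, hv⟩
    rw [← mask_eq_mask_iff.2 hv, ← add_zero v, ← mask_empty_add_mask]
    exact hpath.add_mem_parikhImageFrom hq

end Runs

section MaskedSemilinear

variable {α : Type*}

/-- A set of Parikh images is masked semilinear if for every set `S` of letters its members that
are infinite exactly on `S` form, outside `S`, a semilinear set. The sections are subsets of
`α → ℕ` which do not depend on the coordinates in `S`. -/
def IsMaskedSemilinear (C : Set (α → ℕ∞)) : Prop :=
  ∀ S : Set α, IsSemilinearSet {x : α → ℕ | mask S x ∈ C}

theorem IsMaskedSemilinear.compl [Finite α] {C : Set (α → ℕ∞)} (hC : IsMaskedSemilinear C) :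
    IsMaskedSemilinear Cᶜ :=
  fun S => (hC S).compl

theorem IsMaskedSemilinear.biUnion {ι : Type*} {I : Set ι} (hI : I.Finite)
    {C : ι → Set (α → ℕ∞)} (hC : ∀ i, IsMaskedSemilinear (C i)) :
    IsMaskedSemilinear (⋃ i ∈ I, C i) := by
  intro S
  have h := IsSemilinearSet.biUnion hI fun i _ => hC i S
  simpa only [Set.mem_iUnion, Set.ofPred_exists] using h

theorem isSemilinearSet_setOf_exists_eqOn_compl [Finite α] {V : Set (α → ℕ)}
    (hV : IsSemilinearSet V) (S : Set α) :
    IsSemilinearSet {x : α → ℕ | ∃ v ∈ V, ∀ a ∉ S, v a = x a} := by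
  let π := LinearMap.funLeft ℕ ℕ (Subtype.val : ↥Sᶜ → α)
  have hπ : {x : α → ℕ | ∃ v ∈ V, ∀ a ∉ S, v a = x a} = π ⁻¹' (π '' V) := by
    ext x
    simp [π, funext_iff, LinearMap.funLeft_apply]
  rw [hπ]
  exact (hV.image π).preimage π

theorem isMaskedSemilinear_parikhImageFrom [Finite α] {Q : Type*} [Finite Q] (A : NFA α Q)
    (p : Q) : IsMaskedSemilinear (parikhImageFrom A p) := by
  classical
  intro S
  have h := IsSemilinearSet.biUnion (Set.toFinite {q | mask S 0 ∈ parikhImageFrom A q})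
    fun q _ => isSemilinearSet_setOf_exists_eqOn_compl
      (isSemilinearSet_setOf_pathIn A Set.finite_univ p q) S
  convert h using 1
  ext x
  simp only [Set.mem_iUnion, Set.mem_ofPred_eq, exists_prop]
  exact mask_mem_parikhImageFrom_iff

theorem isMaskedSemilinear_parikhImage [Finite α] {Q : Type*} [Finite Q] (A : NFA α Q) :
    IsMaskedSemilinear (parikhImage A) := by
  rw [parikhImage_eq_biUnion]
  exact .biUnion (Set.toFinite _) (isMaskedSemilinear_parikhImageFrom A)

end MaskedSemilinear

section Recognizable

variable {α : Type*}

/-- A set of Parikh images is recognizable if it is the set of Parikh images of the words accepted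
by some finite automaton. -/
def IsRecognizable (C : Set (α → ℕ∞)) : Prop :=
  ∃ (P : Type) (_ : Finite P) (B : NFA α P), parikhImage B = C

theorem infStates_comp {P P' : Type*} {f : P → P'} (hf : f.Injective) (ρ : ℕ → P) (p : P) :
    f p ∈ infStates (f ∘ ρ) ↔ p ∈ infStates ρ := by
  simp only [infStates, Function.comp_apply, hf.eq_iff, Set.mem_ofPred_eq]

theorem omegaLanguageFrom_eq_of_injective {P P' : Type*} {B : NFA α P} {B' : NFA α P'}
    {f : P → P'} (hf : f.Injective) (hstep : ∀ p a, B'.step (f p) a = f '' B.step p a)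
    (haccept : ∀ p, f p ∈ B'.accept ↔ p ∈ B.accept) (p : P) :
    omegaLanguageFrom B' (f p) = omegaLanguageFrom B p := by
  ext w
  constructor
  · rintro ⟨ρ', ⟨h0, hρ'⟩, q', hq', hacc⟩
    have hrange : ∀ k, ∃ s, f s = ρ' k := by
      intro k
      induction k with
      | zero => exact ⟨p, h0.symm⟩
      | succ k ih =>
        obtain ⟨s, hs⟩ := ih
        have hk := hρ' k
        rw [← hs, hstep] at hk
        exact hk.imp fun _ h => h.2
    choose ρ hρ using hrange
    obtain rfl : f ∘ ρ = ρ' := funext hρ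
    obtain ⟨i, -, rfl⟩ := hq' 0
    refine ⟨ρ, ⟨hf h0, fun k => ?_⟩, ρ i, (infStates_comp hf ρ _).1 hq', (haccept _).1 hacc⟩
    rw [← hf.mem_set_image, ← hstep]
    exact hρ' k
  · rintro ⟨ρ, ⟨rfl, hρ⟩, q, hq, hacc⟩
    refine ⟨f ∘ ρ, ⟨rfl, fun k => ?_⟩, f q, (infStates_comp hf ρ q).2 hq, (haccept q).2 hacc⟩
    rw [Function.comp_apply, Function.comp_apply, hstep]
    exact Set.mem_image_of_mem f (hρ k)

theorem isRecognizable_parikhImage {P : Type*} [Finite P] (B : NFA α P) :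
    IsRecognizable (parikhImage B) := by
  obtain ⟨n, ⟨e⟩⟩ := Finite.exists_equiv_fin P
  let B' : NFA α (Fin n) :=
    ⟨fun i a => e '' B.step (e.symm i) a, e '' B.start, e '' B.accept⟩
  have hB' (p : P) : omegaLanguageFrom B' (e p) = omegaLanguageFrom B p :=
    omegaLanguageFrom_eq_of_injective e.injective (fun p a => by simp [B'])
      (fun p => e.injective.mem_set_image) p
  refine ⟨Fin n, inferInstance, B', ?_⟩
  simp only [parikhImage, omegaLanguage_eq_biUnion, ← hB']
  rw [Set.biUnion_image]

/-- The disjoint union of a family of automata. -/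
def sigmaNFA {ι : Type*} {P : ι → Type*} (B : ∀ i, NFA α (P i)) : NFA α (Σ i, P i) where
  step q a := Sigma.mk q.1 '' (B q.1).step q.2 a
  start := {q | q.2 ∈ (B q.1).start}
  accept := {q | q.2 ∈ (B q.1).accept}

theorem omegaLanguage_sigmaNFA {ι : Type*} {P : ι → Type*} (B : ∀ i, NFA α (P i)) :
    omegaLanguage (sigmaNFA B) = ⋃ i, omegaLanguage (B i) := by
  have hfrom (i : ι) (p : P i) :
      omegaLanguageFrom (sigmaNFA B) ⟨i, p⟩ = omegaLanguageFrom (B i) p :=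
    omegaLanguageFrom_eq_of_injective sigma_mk_injective (fun _ _ => rfl) (fun _ => Iff.rfl) p
  ext w
  simp only [omegaLanguage_eq_biUnion, Set.mem_iUnion, Sigma.exists, hfrom]
  rfl

theorem IsRecognizable.iUnion {ι : Type*} [Finite ι] {C : ι → Set (α → ℕ∞)}
    (hC : ∀ i, IsRecognizable (C i)) : IsRecognizable (⋃ i, C i) := by
  choose P hP B hB using hC
  have h := isRecognizable_parikhImage (sigmaNFA B)
  simpa only [parikhImage, omegaLanguage_sigmaNFA, Set.image_iUnion, ← hB] using h

end Recognizable

section Linear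

variable {α : Type*} [DecidableEq α] {k : ℕ}

/-- An automaton whose words contain every letter `e j` infinitely often and the other letters as
often as some vector of `b + closure T` says. In the state `inl r` the letters counted by `r` are
still to be read, and a vector of `T` may be added to this debt at any step; once the debt is `0`,
the automaton may move to the states `inr j`, which cycle through the letters `e j` and remember
the last letter read. The bound `N` on the debt makes the state space finite. -/
def linearNFA (e : ZMod k → α) (T : Set (α → ℕ)) {N : α → ℕ} (b : Set.Iic N) :
    NFA α (Set.Iic N ⊕ ZMod k) where
  step q a := {q' | match q, q' with
    | .inl r, .inl r' => ∃ t ∈ insert 0 T, r.1 + t = r'.1 + Pi.single a 1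
    | .inl r, .inr j => r.1 = 0 ∧ a = e j
    | .inr i, .inr j => j = i + 1 ∧ a = e j
    | .inr _, .inl _ => False}
  start := {.inl b}
  accept := Set.range .inr

variable {e : ZMod k → α} {T : Set (α → ℕ)} {N : α → ℕ} {b : Set.Iic N}

theorem inr_step_linearNFA {j : ZMod k} {a : α} {q : Set.Iic N ⊕ ZMod k} :
    q ∈ (linearNFA e T b).step (.inr j) a ↔ q = .inr (j + 1) ∧ a = e (j + 1) := by
  rcases q with r | i
  · simp [linearNFA]
  · simp +contextual [linearNFA]

theorem isRunFrom_linearNFA_inr_iff {j : ZMod k} {w : ℕ → α} {ρ : ℕ → Set.Iic N ⊕ ZMod k} :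
    IsRunFrom (linearNFA e T b) (.inr j) w ρ ↔
      (ρ = fun i : ℕ => .inr (j + i)) ∧ w = fun i : ℕ => e (j + 1 + i) := by
  constructor
  · rintro ⟨h0, hstep⟩
    have hρ : ∀ i : ℕ, ρ i = .inr (j + i) := by
      intro i
      induction i with
      | zero => simpa using h0
      | succ i ih =>
        have hi := hstep i
        rw [ih, inr_step_linearNFA] at hi
        rw [hi.1, Nat.cast_succ, add_assoc]
    refine ⟨funext hρ, funext fun i => ?_⟩
    have hi := hstep i
    rw [hρ, inr_step_linearNFA] at hi
    rw [hi.2, add_right_comm]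
  · rintro ⟨rfl, rfl⟩
    refine ⟨by simp, fun i => inr_step_linearNFA.2 ⟨?_, ?_⟩⟩
    · simp only [Nat.cast_succ, add_assoc]
    · rw [add_right_comm]

theorem parikhImageFrom_linearNFA_inr [NeZero k] (j : ZMod k) :
    parikhImageFrom (linearNFA e T b) (.inr j) = {mask (Set.range e) 0} := by
  ext c
  rw [Set.mem_singleton_iff]
  constructor
  · rintro ⟨w, ⟨ρ, hρ, -⟩, rfl⟩
    rw [(isRunFrom_linearNFA_inr_iff.1 hρ).2, parikh_cyclic]
  · rintro rfl
    refine ⟨_, ⟨_, isRunFrom_linearNFA_inr_iff.2 ⟨rfl, rfl⟩, .inr j, ?_, Set.mem_range_self j⟩,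
      parikh_cyclic e (j + 1)⟩
    exact mem_infStates_iff.2 <|
      (frequently_add_natCast_eq j j).mono fun i hi => congrArg Sum.inr hi

theorem exists_parikh_eq_of_isRunFrom_linearNFA [NeZero k] {r : Set.Iic N} {w : ℕ → α}
    {ρ : ℕ → Set.Iic N ⊕ ZMod k} (hρ : IsRunFrom (linearNFA e T b) (.inl r) w ρ) {m : ℕ}
    {j : ZMod k} (hm : ρ m = .inr j) :
    ∃ y ∈ AddSubmonoid.closure T, parikh w = mask (Set.range e) (r.1 + y) := by
  induction m generalizing r w ρ with
  | zero => simp [hρ.1] at hm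
  | succ m ih =>
    have htail := hρ.add 1
    have hstep := hρ.2 0
    rw [hρ.1, zero_add] at hstep
    rw [parikh_eq_single_add w]
    rcases h1 : ρ 1 with r' | i <;> rw [h1] at htail hstep
    · obtain ⟨y, hy, hwy⟩ := ih htail hm
      obtain ⟨t, ht, hrt⟩ := hstep
      have ht' : t ∈ AddSubmonoid.closure T := by
        rcases ht with rfl | ht
        exacts [zero_mem _, AddSubmonoid.subset_closure ht]
      refine ⟨t + y, add_mem ht' hy, ?_⟩
      rw [hwy, mask_empty_add_mask, ← add_assoc r.1, hrt, ← add_assoc, add_comm r'.1]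
    · obtain ⟨hr, hi⟩ := hstep
      refine ⟨0, zero_mem _, ?_⟩
      rw [(isRunFrom_linearNFA_inr_iff.1 htail).2, parikh_cyclic, mask_empty_add_mask,
        mask_single_add_of_mem (Set.mem_range.2 ⟨i, hi.symm⟩), hr, add_zero]

variable [Finite α]

theorem add_mem_parikhImageFrom_linearNFA_inl {c : α → ℕ∞}
    (hc : c ∈ parikhImageFrom (linearNFA e T b) (.inl ⟨0, Set.mem_Iic.2 zero_le⟩))
    {r : α → ℕ} (hr : r ≤ N) :
    mask ∅ r + c ∈ parikhImageFrom (linearNFA e T b) (.inl ⟨r, hr⟩) := by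
  induction r using induction_add_single with
  | zero => rwa [mask_empty_zero, zero_add]
  | add_single r a ih =>
    have hr' : r ≤ N := le_self_add.trans hr
    have h := single_add_mem_parikhImageFrom (A := linearNFA e T b) (q := .inl ⟨_, hr⟩)
      (r := .inl ⟨r, hr'⟩) ⟨0, Set.mem_insert 0 T, add_zero _⟩ (ih hr')
    rwa [← add_assoc, mask_empty_add_mask, add_comm _ r] at h

theorem period_add_mem_parikhImageFrom_linearNFA {c : α → ℕ∞} {t : α → ℕ} (ht : t ∈ T)
    (htN : t ≤ N)
    (hc : c ∈ parikhImageFrom (linearNFA e T b) (.inl ⟨0, Set.mem_Iic.2 zero_le⟩)) :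
    mask ∅ t + c ∈ parikhImageFrom (linearNFA e T b) (.inl ⟨0, Set.mem_Iic.2 zero_le⟩) := by
  induction t using induction_add_single with
  | zero => rwa [mask_empty_zero, zero_add]
  | add_single r a _ =>
    have hr : r ≤ N := le_self_add.trans htN
    have h := single_add_mem_parikhImageFrom (A := linearNFA e T b)
      (q := .inl ⟨0, Set.mem_Iic.2 zero_le⟩) (r := .inl ⟨r, hr⟩)
      ⟨_, Set.mem_insert_of_mem 0 ht, zero_add _⟩ (add_mem_parikhImageFrom_linearNFA_inl hc hr)
    rwa [← add_assoc, mask_empty_add_mask, add_comm _ r] at h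

theorem mask_mem_parikhImageFrom_linearNFA [NeZero k] (hT : ∀ t ∈ T, t ≤ N) {y : α → ℕ}
    (hy : y ∈ AddSubmonoid.closure T) :
    mask (Set.range e) y ∈ parikhImageFrom (linearNFA e T b) (.inl ⟨0, Set.mem_Iic.2 zero_le⟩) := by
  induction hy using AddSubmonoid.closure_induction_left with
  | zero =>
    rw [← mask_single_add_of_mem (Set.mem_range_self 0), ← mask_empty_add_mask]
    refine single_add_mem_parikhImageFrom (r := .inr (0 : ZMod k)) (And.intro rfl rfl) ?_
    rw [parikhImageFrom_linearNFA_inr]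
    rfl
  | add_left t ht y _ ih =>
    rw [← mask_empty_add_mask]
    exact period_add_mem_parikhImageFrom_linearNFA ht (hT t ht) ih

theorem parikhImage_linearNFA [NeZero k] (hT : ∀ t ∈ T, t ≤ N) :
    parikhImage (linearNFA e T b) =
      mask (Set.range e) '' (b.1 +ᵥ (AddSubmonoid.closure T : Set (α → ℕ))) := by
  rw [parikhImage_eq_biUnion, ← Set.image_vadd, Set.image_image]
  simp only [linearNFA, Set.biUnion_singleton]
  change parikhImageFrom (linearNFA e T b) (.inl b) = _
  apply Set.Subset.antisymm
  · rintro _ ⟨w, ⟨ρ, hρ, _, hinf, j, rfl⟩, rfl⟩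
    obtain ⟨m, -, hm⟩ := hinf 0
    obtain ⟨y, hy, hwy⟩ := exists_parikh_eq_of_isRunFrom_linearNFA hρ hm
    exact ⟨y, hy, hwy.symm⟩
  · rintro _ ⟨y, hy, rfl⟩
    change mask _ (b.1 + y) ∈ _
    rw [← mask_empty_add_mask]
    exact add_mem_parikhImageFrom_linearNFA_inl (mask_mem_parikhImageFrom_linearNFA hT hy) b.2

end Linear

section Realization

variable {α : Type*} [Finite α] {S : Set α} {X : Set (α → ℕ)}

theorem exists_zmod_range_eq (hS : S.Nonempty) :
    ∃ (k : ℕ) (_ : NeZero k) (e : ZMod k → α), Set.range e = S := by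
  have := hS.to_subtype
  have : NeZero (Nat.card S) := ⟨Nat.card_pos.ne'⟩
  obtain ⟨f⟩ : Nonempty (ZMod (Nat.card S) ≃ S) := Finite.card_eq.1 (Nat.card_zmod _)
  refine ⟨Nat.card S, this, Subtype.val ∘ f, ?_⟩
  rw [f.surjective.range_comp, Subtype.range_val]

theorem isRecognizable_image_mask_of_isLinearSet (hS : S.Nonempty) (hX : IsLinearSet X) :
    IsRecognizable (mask S '' X) := by
  classical
  have := Fintype.ofFinite α
  obtain ⟨k, _, e, rfl⟩ := exists_zmod_range_eq hS
  obtain ⟨b, T, hT, rfl⟩ := hX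
  obtain ⟨N, hN⟩ := (hT.insert b).bddAbove
  have : Finite (Set.Iic N) := (Set.finite_Iic N).to_subtype
  rw [← parikhImage_linearNFA (b := ⟨b, hN (Set.mem_insert b T)⟩)
    fun t ht => hN (Set.mem_insert_of_mem b ht)]
  exact isRecognizable_parikhImage _

theorem isRecognizable_image_mask_of_isSemilinearSet (hS : S.Nonempty) (hX : IsSemilinearSet X) :
    IsRecognizable (mask S '' X) := by
  obtain ⟨𝒳, h𝒳, hlin, rfl⟩ := hX
  have := h𝒳.to_subtype
  rw [Set.sUnion_eq_iUnion, Set.image_iUnion]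
  exact .iUnion fun Y => isRecognizable_image_mask_of_isLinearSet hS (hlin Y Y.2)

theorem IsMaskedSemilinear.isRecognizable {C : Set (α → ℕ∞)} (hC : IsMaskedSemilinear C) :
    IsRecognizable (C ∩ {c | ∃ a, c a = ⊤}) := by
  have hunion : C ∩ {c | ∃ a, c a = ⊤} =
      ⋃ S : {S : Set α // S.Nonempty}, mask S.1 '' {x | mask S.1 x ∈ C} := by
    apply Set.Subset.antisymm
    · rintro c ⟨hc, htop⟩
      obtain ⟨x, hx⟩ := exists_mask_eq c
      exact Set.mem_iUnion.2 ⟨⟨_, htop⟩, x, by rwa [← hx] at hc, hx⟩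
    · refine Set.iUnion_subset fun ⟨S, a, ha⟩ => ?_
      rintro _ ⟨x, hx, rfl⟩
      exact ⟨hx, a, mask_of_mem ha⟩
  rw [hunion]
  exact .iUnion fun S => isRecognizable_image_mask_of_isSemilinearSet S.2 (hC S)

end Realization

end JumpingAutomata

theorem mainTheorem3 {α : Type*} [Finite α] {Q : Type*} [Finite Q] (A : NFA α Q) :
    ∃ (P : Type) (_ : Finite P) (B : NFA α P),
      JumpingAutomata.jumpingLanguage B = (JumpingAutomata.jumpingLanguage A)ᶜ := by
  open JumpingAutomata in
  obtain ⟨P, hP, B, hB⟩ := (isMaskedSemilinear_parikhImage A).compl.isRecognizable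
  refine ⟨P, hP, B, ?_⟩
  ext w
  rw [mem_jumpingLanguage_iff, hB, Set.mem_compl_iff, mem_jumpingLanguage_iff]
  exact and_iff_left (exists_parikh_eq_top w)
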